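/- **Theorem (exponential stability under frictional damping).** Let $d\ge 1$, let $\Omega\subset\mathbb{R}^d$ be a bounded open set (for instance, a bounded domain with Lipschitz boundary), and use the summation convention over indices in $\{1,\dots,d\}$. Let $\rho,a>0$ and let $A_{iJKj}$, $\beta_{Ji}$, $C_{iJKLIj}$, $M_{iJKL}$, $K_{IJ}$, $m_{IJ}$, $E_{ij}$ be real constants. Assume that there is $\alpha>0$ such that for all real $P_{iK}$, $\xi_I$ and all real $H_{iJK}$ with $H_{iJK}=H_{iKJ}$ $$A_{iKLj}P_{iK}P_{jL}\ge\alpha P_{kR}P_{kR},$$ $$C_{iIJKLj}H_{iJI}H_{jLK}+M_{iJKL}H_{iKJ}\xi_L+M_{jLKI}H_{jLK}\xi_I+K_{IJ}\xi_I\xi_J\ge\alpha(\xi_R\xi_R+H_{kST}H_{kST}),$$ $$E_{ij}\xi_i\xi_j\ge\alpha\,\xi_i\xi_i,\qquad m_{IJ}\xi_I\xi_J\ge\alpha\,\xi_I\xi_I .$$ Let $H^s_0(\Omega)$ be the closure of $C_c^\infty(\Omega)$ in the $H^s$-norm, let $$\mathcal H=(H^2_0(\Omega))^d\times(L^2(\Omega))^d\times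 H^1_0(\Omega)\times L^2(\Omega)\ni U=(u,v,\tau,\theta),$$ and assume that the bilinear form $$\langle U,U^*\rangle_{\mathcal H}=\int_\Omega\big(\rho v_iv_i^*+a\theta\theta^*+A_{iKLj}u_{i,K}u^*_{j,L}+C_{iIJKLj}u_{i,JI}u^*_{j,LK}+K_{IJ}\tau_{,J}\tau^*_{,I}+M_{iJKL}u_{i,KJ}\tau^*_{,L}+M_{jLKI}u^*_{j,KL}\tau_{,I}\big)\,dx$$ is symmetric on $\mathcal H$ (as is the case, e.g., if $A_{iKLj}=A_{jLKi}$, $C_{iIJKLj}=C_{jKLIJi}$ and $K_{IJ}=K_{JI}$). Consider in $\Omega\times(0,\infty)$ the system $$\rho\ddot u_i=\big(A_{iJKj}u_{j,K}-\beta_{Ji}\dot\tau-(C_{iJKLIj}u_{j,IL}+M_{iJKL}\tau_{,L})_{,K}\big)_{,J}-E_{ij}\dot u_j,$$ $$a\ddot\tau=-\beta_{Ki}\dot u_{i,K}+m_{IJ}\dot\tau_{,IJ}+M_{jLKI}u_{j,LKI}+K_{IJ}\tau_{,IJ}$$ with the boundary conditions $u_i=0$, $u_{i,J}=0$, $\tau=0$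 on $\partial\Omega\times(0,\infty)$, written as the evolution equation $\dot U=\mathcal A U$, $U(0)=U_0$, in $\mathcal H$ for $U=(u,v,\tau,\theta)$ with $v=\dot u$, $\theta=\dot\tau$. Here $D(\mathcal A)$ consists of those $U\in\mathcal H$ with $v\in(H^2_0(\Omega))^d$, $\theta\in H^1_0(\Omega)$ for which the right-hand sides of the two equations, taken in the sense of distributions, are in $L^2(\Omega)$. A mild solution with initial datum $U_0\in\mathcal H$ is a continuous $U:[0,\infty)\to\mathcal H$ such that $U(0)=U_0$ and, for all $t\ge0$, $\int_0^tU(s)\,ds\in D(\mathcal A)$ and $U(t)=U_0+\mathcal A\int_0^tU(s)\,ds$. Its energy is $$\mathcal E(t)=\frac12\int_\Omega\big(\rho\,\dot u_i\dot u_i+a\dot\tau^2+A_{iKLj}u_{i,K}u_{j,L}+C_{iIJKLj}u_{i,JI}u_{j,LK}+K_{IJ}\tau_{,I}\tau_{,J}+2M_{iJKL}u_{i,KJ}\tau_{,L}\big)\,dx ,$$ where $\dot u=v$ and $\dot\tau=\theta$. Then there exist constants $C,c_0>0$, independent of the initial datum, such that for every $U_0\in\mathcal H$ every mild solution $U$ with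 initial datum $U_0$ satisfies $$\mathcal E(t)\le C\,\mathcal E(0)\,e^{-c_0t}\qquad\text{for all }t\ge0 .$$ -/

import Mathlib

noncomputable section

namespace NonsimpleThermo

open MeasureTheory TopologicalSpace Set
open scoped Distributions LineDeriv InnerProductSpace

/-! ### Function spaces -/

/-- Euclidean space `ℝ^d`. -/
abbrev Space (d : ℕ) : Type := EuclideanSpace ℝ (Fin d)

variable {d : ℕ} {Ω : Opens (Space d)}

/-- The real Hilbert space `L²(Ω)` (Lebesgue measure). Its inner product `⟪f, g⟫_ℝ` is
`∫_Ω f g dx`. -/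
abbrev L2 (Ω : Opens (Space d)) : Type :=
  Lp ℝ 2 ((volume : Measure (Space d)).restrict (Ω : Set (Space d)))

/-- The partial derivative `φ_{,K}` of a test function `φ ∈ C_c^∞(Ω)`. -/
def pd (K : Fin d) (φ : 𝓓(Ω, ℝ)) : 𝓓(Ω, ℝ) := ∂_{(EuclideanSpace.single K (1 : ℝ) : Space d)} φ

/-- A test function is square integrable. -/
theorem memLp_testFunction (φ : 𝓓(Ω, ℝ)) :
    MemLp φ 2 ((volume : Measure (Space d)).restrict (Ω : Set (Space d))) :=
  φ.continuous.memLp_of_hasCompactSupport φ.hasCompactSupport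

/-- A test function as an element of `L²(Ω)`, as a linear map. -/
def toL2 : 𝓓(Ω, ℝ) →ₗ[ℝ] L2 Ω where
  toFun φ := (memLp_testFunction φ).toLp φ
  map_add' _ _ := rfl
  map_smul' _ _ := rfl

theorem pd_add (K : Fin d) (φ ψ : 𝓓(Ω, ℝ)) : pd K (φ + ψ) = pd K φ + pd K ψ :=
  LineDeriv.lineDerivOp_add _ φ ψ

theorem pd_smul (K : Fin d) (c : ℝ) (φ : 𝓓(Ω, ℝ)) : pd K (c • φ) = c • pd K φ :=
  LineDeriv.lineDerivOp_smul _ c φ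

/-- The first order jet `(φ, (φ_{,K})_K)` of a test function, as an element of `L²` products. -/
def jet1 (Ω : Opens (Space d)) : 𝓓(Ω, ℝ) →ₗ[ℝ] L2 Ω × (Fin d → L2 Ω) where
  toFun φ := (toL2 φ, fun K => toL2 (pd K φ))
  map_add' φ ψ := by
    ext1
    · simp
    · funext K; simp [pd_add]
  map_smul' c φ := by
    ext1
    · simp
    · funext K; simp [pd_smul]

/-- The second order jet `(φ, (φ_{,K})_K, (φ_{,KL})_{K,L})` of a test function, as an element of
`L²` products. -/
def jet2 (Ω : Opens (Space d)) :
    𝓓(Ω, ℝ) →ₗ[ℝ] L2 Ω × (Fin d → L2 Ω) × (Fin d → Fin d → L2 Ω) where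
  toFun φ := (toL2 φ, fun K => toL2 (pd K φ), fun K L => toL2 (pd L (pd K φ)))
  map_add' φ ψ := by
    ext1
    · simp
    · ext1
      · funext K; simp [pd_add]
      · funext K L; simp [pd_add]
  map_smul' c φ := by
    ext1
    · simp
    · ext1
      · funext K; simp [pd_smul]
      · funext K L; simp [pd_smul]

/-- `H¹₀(Ω) = clos (C_c^∞(Ω), ‖·‖_{H¹})`. An element is stored together with its weak gradient:
it is a pair `(w, (w_{,K})_K)` and `H¹₀(Ω)` is the closure of the pairs coming from test functions
in the product of `L²` spaces, the topology of which is that of the `H¹`-norm. -/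
def H01 (Ω : Opens (Space d)) : Submodule ℝ (L2 Ω × (Fin d → L2 Ω)) :=
  (LinearMap.range (jet1 Ω)).topologicalClosure

/-- `H²₀(Ω) = clos (C_c^∞(Ω), ‖·‖_{H²})`. An element is stored together with its weak derivatives
of order at most two: it is a triple `(w, (w_{,K})_K, (w_{,KL})_{K,L})` and `H²₀(Ω)` is the closure
of the triples coming from test functions in the product of `L²` spaces, the topology of which is
that of the `H²`-norm. -/
def H02 (Ω : Opens (Space d)) :
    Submodule ℝ (L2 Ω × (Fin d → L2 Ω) × (Fin d → Fin d → L2 Ω)) :=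
  (LinearMap.range (jet2 Ω)).topologicalClosure

/-- Integration by parts for test functions. -/
theorem inner_pd (K : Fin d) (φ ψ : 𝓓(Ω, ℝ)) :
    ⟪toL2 (pd K φ), toL2 ψ⟫_ℝ = -⟪toL2 φ, toL2 (pd K ψ)⟫_ℝ := by
  have key : ∀ f g : 𝓓(Ω, ℝ), ⟪toL2 f, toL2 g⟫_ℝ = ∫ x : Space d, g x * f x := by
    intro f g
    have h1 : ⟪toL2 f, toL2 g⟫_ℝ = ∫ x in (Ω : Set (Space d)), g x * f x := by
      rw [L2.inner_def]
      refine integral_congr_ae ?_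
      filter_upwards [(memLp_testFunction f).coeFn_toLp, (memLp_testFunction g).coeFn_toLp]
        with x hf hg
      change ⟪((memLp_testFunction f).toLp f : Space d → ℝ) x,
        ((memLp_testFunction g).toLp g : Space d → ℝ) x⟫_ℝ = _
      rw [hf, hg]
      simp
    rw [h1]
    refine setIntegral_eq_integral_of_forall_compl_eq_zero fun x hx => ?_
    have : g x = 0 := by
      by_contra h
      exact hx (g.tsupport_subset (subset_tsupport _ h))
    simp [this]
  have hpd : ∀ (f : 𝓓(Ω, ℝ)) (x : Space d),
      pd K f x = fderiv ℝ f x (EuclideanSpace.single K (1 : ℝ)) := by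
    intro f x
    have h := TestFunction.fderivCLM_apply_of_le (𝕜 := ℝ) (n := ⊤) (k := ⊤) f le_rfl
    exact congrArg (fun T => T x (EuclideanSpace.single K (1 : ℝ))) h
  have hint : ∀ f g : 𝓓(Ω, ℝ), Integrable (fun x : Space d => f x * g x) := fun f g =>
    (f.continuous.mul g.continuous).integrable_of_hasCompactSupport f.hasCompactSupport.mul_right
  have hdiff : ∀ f : 𝓓(Ω, ℝ), Differentiable ℝ f := fun f =>
    f.contDiff.differentiable (by simp)
  rw [key, key]
  simp only [hpd]
  have hi1 := hint (pd K ψ) φ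
  have hi2 := hint ψ (pd K φ)
  have hi3 := hint ψ φ
  simp only [hpd] at hi1 hi2
  rw [integral_mul_fderiv_eq_neg_fderiv_mul_of_integrable hi1 hi2 hi3
    (fun x _ => hdiff ψ x) (fun x _ => hdiff φ x)]

/-- The components `w_{,K}` of `w ∈ H¹₀(Ω)` are the weak derivatives of `w`. -/
theorem H01_weakDeriv (w : H01 Ω) (K : Fin d) (φ : 𝓓(Ω, ℝ)) :
    ⟪w.1.2 K, toL2 φ⟫_ℝ = -⟪w.1.1, toL2 (pd K φ)⟫_ℝ := by
  have hcl : IsClosed {w : L2 Ω × (Fin d → L2 Ω) |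
      ⟪w.2 K, toL2 φ⟫_ℝ = -⟪w.1, toL2 (pd K φ)⟫_ℝ} :=
    isClosed_eq (by fun_prop) (by fun_prop)
  have hw := SetLike.mem_coe.2 (show w.1 ∈ (LinearMap.range (jet1 Ω)).topologicalClosure from w.2)
  rw [Submodule.topologicalClosure_coe] at hw
  refine closure_minimal (s := (LinearMap.range (jet1 Ω) : Set _)) ?_ hcl hw
  rintro _ ⟨ψ, rfl⟩
  exact inner_pd K ψ φ

/-- The components `w_{,K}` of `w ∈ H²₀(Ω)` are the weak derivatives of `w`. -/
theorem H02_weakDeriv (w : H02 Ω) (K : Fin d) (φ : 𝓓(Ω, ℝ)) :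
    ⟪w.1.2.1 K, toL2 φ⟫_ℝ = -⟪w.1.1, toL2 (pd K φ)⟫_ℝ := by
  have hcl : IsClosed {w : L2 Ω × (Fin d → L2 Ω) × (Fin d → Fin d → L2 Ω) |
      ⟪w.2.1 K, toL2 φ⟫_ℝ = -⟪w.1, toL2 (pd K φ)⟫_ℝ} :=
    isClosed_eq (by fun_prop) (by fun_prop)
  have hw := SetLike.mem_coe.2 (show w.1 ∈ (LinearMap.range (jet2 Ω)).topologicalClosure from w.2)
  rw [Submodule.topologicalClosure_coe] at hw
  refine closure_minimal (s := (LinearMap.range (jet2 Ω) : Set _)) ?_ hcl hw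
  rintro _ ⟨ψ, rfl⟩
  exact inner_pd K ψ φ

/-- The components `w_{,KL}` of `w ∈ H²₀(Ω)` are the weak derivatives of `w_{,K}`. -/
theorem H02_weakDeriv2 (w : H02 Ω) (K L : Fin d) (φ : 𝓓(Ω, ℝ)) :
    ⟪w.1.2.2 K L, toL2 φ⟫_ℝ = -⟪w.1.2.1 K, toL2 (pd L φ)⟫_ℝ := by
  have hcl : IsClosed {w : L2 Ω × (Fin d → L2 Ω) × (Fin d → Fin d → L2 Ω) |
      ⟪w.2.2 K L, toL2 φ⟫_ℝ = -⟪w.2.1 K, toL2 (pd L φ)⟫_ℝ} :=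
    isClosed_eq (by fun_prop) (by fun_prop)
  have hw := SetLike.mem_coe.2 (show w.1 ∈ (LinearMap.range (jet2 Ω)).topologicalClosure from w.2)
  rw [Submodule.topologicalClosure_coe] at hw
  refine closure_minimal (s := (LinearMap.range (jet2 Ω) : Set _)) ?_ hcl hw
  rintro _ ⟨ψ, rfl⟩
  exact inner_pd L (pd K ψ) φ

/-- The state space
`𝓗 = (H²₀(Ω))^d × (L²(Ω))^d × H¹₀(Ω) × L²(Ω)` of the tuples `U = (u, v, τ, θ)`, with the product
topology. -/
abbrev State (Ω : Opens (Space d)) : Type :=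
  (Fin d → H02 Ω) × (Fin d → L2 Ω) × H01 Ω × L2 Ω

namespace State

/-- `u_i` -/
def u (U : State Ω) (i : Fin d) : L2 Ω := (U.1 i).1.1

/-- `u_{i,K}` -/
def du (U : State Ω) (i K : Fin d) : L2 Ω := (U.1 i).1.2.1 K

/-- `u_{i,KL}` -/
def ddu (U : State Ω) (i K L : Fin d) : L2 Ω := (U.1 i).1.2.2 K L

/-- `v_i` -/
def v (U : State Ω) (i : Fin d) : L2 Ω := U.2.1 i

/-- `τ` -/
def τ (U : State Ω) : L2 Ω := U.2.2.1.1.1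

/-- `τ_{,K}` -/
def dτ (U : State Ω) (K : Fin d) : L2 Ω := U.2.2.1.1.2 K

/-- `θ` -/
def θ (U : State Ω) : L2 Ω := U.2.2.2

end State

/-! ### The system -/

/-- The (constant, real) coefficients `ρ, a, A_{iJKj}, β_{Ji}, C_{iJKLIj}, M_{iJKL}, K_{IJ},
m_{IJ}, E_{ij}`. This is pure data; every condition on it is stated separately. -/
structure Coeffs (d : ℕ) where
  ρ : ℝ
  a : ℝ
  A : Fin d → Fin d → Fin d → Fin d → ℝ
  β : Fin d → Fin d → ℝ
  C : Fin d → Fin d → Fin d → Fin d → Fin d → Fin d → ℝ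
  M : Fin d → Fin d → Fin d → Fin d → ℝ
  K : Fin d → Fin d → ℝ
  m : Fin d → Fin d → ℝ
  E : Fin d → Fin d → ℝ

namespace Coeffs

variable (p : Coeffs d)

/-- `A_{iKLj} P_{iK} P_{jL} ≥ α P_{kR} P_{kR}` for some `α > 0`. -/
def PosA : Prop :=
  ∃ α : ℝ, 0 < α ∧ ∀ P : Fin d → Fin d → ℝ,
    α * ∑ k, ∑ R, P k R ^ 2 ≤ ∑ i, ∑ K, ∑ L, ∑ j, p.A i K L j * P i K * P j L

/-- `C_{iIJKLj} H_{iJI} H_{jLK} + M_{iJKL} H_{iKJ} ξ_L + M_{jLKI} H_{jLK} ξ_I + K_{IJ} ξ_I ξ_J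
≥ α (ξ_R ξ_R + H_{kST} H_{kST})` for some `α > 0`. Here `H_{iJK}` stands for the second derivatives
`u_{i,JK}`, hence it is symmetric in its last two indices, and `ξ_I` stands for `τ_{,I}`. -/
def PosCMK : Prop :=
  ∃ α : ℝ, 0 < α ∧ ∀ (H : Fin d → Fin d → Fin d → ℝ) (ξ : Fin d → ℝ),
    (∀ i J K, H i J K = H i K J) →
    α * (∑ R, ξ R ^ 2 + ∑ k, ∑ S, ∑ T, H k S T ^ 2) ≤
      (∑ i, ∑ I, ∑ J, ∑ K, ∑ L, ∑ j, p.C i I J K L j * H i J I * H j L K)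
      + (∑ i, ∑ J, ∑ K, ∑ L, p.M i J K L * H i K J * ξ L)
      + (∑ j, ∑ L, ∑ K, ∑ I, p.M j L K I * H j L K * ξ I)
      + ∑ I, ∑ J, p.K I J * ξ I * ξ J

/-- `E_{ij} ξ_i ξ_j ≥ α ξ_i ξ_i` for some `α > 0` (no symmetry of `E` is assumed). -/
def PosE : Prop :=
  ∃ α : ℝ, 0 < α ∧ ∀ ξ : Fin d → ℝ, α * ∑ i, ξ i ^ 2 ≤ ∑ i, ∑ j, p.E i j * ξ i * ξ j

/-- `m_{IJ} ξ_I ξ_J ≥ α ξ_I ξ_I` for some `α > 0` (no symmetry of `m` is assumed). -/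
def PosM : Prop :=
  ∃ α : ℝ, 0 < α ∧ ∀ ξ : Fin d → ℝ, α * ∑ I, ξ I ^ 2 ≤ ∑ I, ∑ J, p.m I J * ξ I * ξ J

end Coeffs

/-- The weighted bilinear form `⟨U, U*⟩_𝓗` on `𝓗`. -/
def form (p : Coeffs d) (U V : State Ω) : ℝ :=
  p.ρ * ∑ i, ⟪U.v i, V.v i⟫_ℝ
  + p.a * ⟪U.θ, V.θ⟫_ℝ
  + (∑ i, ∑ K, ∑ L, ∑ j, p.A i K L j * ⟪U.du i K, V.du j L⟫_ℝ)
  + (∑ i, ∑ I, ∑ J, ∑ K, ∑ L, ∑ j, p.C i I J K L j * ⟪U.ddu i J I, V.ddu j L K⟫_ℝ)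
  + (∑ I, ∑ J, p.K I J * ⟪U.dτ J, V.dτ I⟫_ℝ)
  + (∑ i, ∑ J, ∑ K, ∑ L, p.M i J K L * ⟪U.ddu i K J, V.dτ L⟫_ℝ)
  + ∑ j, ∑ L, ∑ K, ∑ I, p.M j L K I * ⟪V.ddu j K L, U.dτ I⟫_ℝ

/-- The energy `𝓔` of a state `(u, v, τ, θ)` (with `v = u̇`, `θ = τ̇` along a solution). -/
def energy (p : Coeffs d) (U : State Ω) : ℝ :=
  1 / 2 * (p.ρ * (∑ i, ⟪U.v i, U.v i⟫_ℝ) + p.a * ⟪U.θ, U.θ⟫_ℝ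
    + (∑ i, ∑ K, ∑ L, ∑ j, p.A i K L j * ⟪U.du i K, U.du j L⟫_ℝ)
    + ∑ i, ∑ I, ∑ J, ∑ K, ∑ L, ∑ j, p.C i I J K L j * ⟪U.ddu i J I, U.ddu j L K⟫_ℝ)
  + 1 / 2 * ((∑ I, ∑ J, p.K I J * ⟪U.dτ I, U.dτ J⟫_ℝ)
    + 2 * ∑ i, ∑ J, ∑ K, ∑ L, p.M i J K L * ⟪U.ddu i K J, U.dτ L⟫_ℝ)

/-- `InGenerator p U F` says `U ∈ D(𝒜)` and `𝒜 U = F`, where `𝒜` is the (unbounded) operator on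
`𝓗` of the first order system for `U = (u, v, τ, θ)`, `v = u̇`, `θ = τ̇`:
`(𝒜U)₁ = v_i`,
`(𝒜U)₂ = ρ⁻¹ ((A_{iJKj} u_{j,K} - β_{Ji} θ - (C_{iJKLIj} u_{j,IL} + M_{iJKL} τ_{,L})_{,K})_{,J}
  - E_{ij} v_j)`,
`(𝒜U)₃ = θ`,
`(𝒜U)₄ = a⁻¹ (-β_{Ki} v_{i,K} + (m_{IJ} θ_{,J} + M_{jLKI} u_{j,LK} + K_{IJ} τ_{,J})_{,I})`.
The first and third equations contain `v_i ∈ H²₀(Ω)` and `θ ∈ H¹₀(Ω)`, whose weak derivatives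
are `v_{i,K} = F.du i K` and `θ_{,J} = F.dτ J`; the expressions on the right are taken in the sense
of distributions on `Ω` and have to be represented by `L²`-functions. -/
structure InGenerator (p : Coeffs d) (U F : State Ω) : Prop where
  fst : ∀ i, F.u i = U.v i
  snd : ∀ (i : Fin d) (φ : 𝓓(Ω, ℝ)),
    p.ρ * ⟪F.v i, toL2 φ⟫_ℝ =
      -(∑ J, ∑ K, ∑ j, p.A i J K j * ⟪U.du j K, toL2 (pd J φ)⟫_ℝ)
      + (∑ J, p.β J i * ⟪U.θ, toL2 (pd J φ)⟫_ℝ)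
      - (∑ J, ∑ K, ∑ L, ∑ I, ∑ j, p.C i J K L I j * ⟪U.ddu j I L, toL2 (pd J (pd K φ))⟫_ℝ)
      - (∑ J, ∑ K, ∑ L, p.M i J K L * ⟪U.dτ L, toL2 (pd J (pd K φ))⟫_ℝ)
      - ∑ j, p.E i j * ⟪U.v j, toL2 φ⟫_ℝ
  trd : F.τ = U.θ
  fth : ∀ φ : 𝓓(Ω, ℝ),
    p.a * ⟪F.θ, toL2 φ⟫_ℝ =
      -(∑ K, ∑ i, p.β K i * ⟪F.du i K, toL2 φ⟫_ℝ)
      - (∑ I, ∑ J, p.m I J * ⟪F.dτ J, toL2 (pd I φ)⟫_ℝ)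
      - (∑ j, ∑ L, ∑ K, ∑ I, p.M j L K I * ⟪U.ddu j L K, toL2 (pd I φ)⟫_ℝ)
      - ∑ I, ∑ J, p.K I J * ⟪U.dτ J, toL2 (pd I φ)⟫_ℝ

/-- `U` is a mild solution on `[0, ∞)` of `U̇ = 𝒜 U`, `U(0) = U₀`: it is continuous with values in
`𝓗` and for all `t ≥ 0` the integral `∫₀ᵗ U ds` lies in `D(𝒜)` with `𝒜 ∫₀ᵗ U ds = U(t) - U₀`. -/
structure IsMildSolution (p : Coeffs d) (U₀ : State Ω) (U : ℝ → State Ω) : Prop where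
  continuousOn : ContinuousOn U (Ici 0)
  initial : U 0 = U₀
  integrated : ∀ t : ℝ, 0 ≤ t → InGenerator p (∫ s in (0 : ℝ)..t, U s) (U t - U₀)

end NonsimpleThermo

end

noncomputable section

namespace NonsimpleThermo

open MeasureTheory TopologicalSpace Set
open scoped Distributions LineDeriv InnerProductSpace

variable {d : ℕ} {Ω : Opens (Space d)} {p : Coeffs d}

/-! The argument is a Lyapunov functional for smooth-in-time solutions, followed by time averaging
for mild ones.

Testing the system with (v, θ) cancels the β-coupling and leaves the energy identity
(`InGenerator.form_self_eq`): friction dissipates ‖v‖² and the m-term dissipates ‖∇θ‖², hence also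
‖θ‖² by Poincaré. Nothing is dissipated in u and τ themselves. Testing with (u, τ) supplies them
(`InGenerator.multiplier`): the derivative of `mixed` is -2𝓔 plus terms that are either dissipated
or products of a dissipated quantity with u, ∇u or ∇τ. Young's inequality, Poincaré and coercivity
absorb the latter into one copy of 𝓔, leaving -𝓔 plus a multiple of ‖v‖² + ‖∇θ‖²
(`InGenerator.exists_multiplier_le`). For large N the functional N𝓔 + `mixed` is equivalent to 𝓔 and
decays exponentially (`exists_decay_of_classical`).

For a mild solution, the integral over [t, t + h] is differentiable in t with values in the domain
of the generator, so the decay applies to it. Rescaling by 1/h and letting h → 0 gives the claim,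
since the energy is continuous and the constants do not depend on the datum
(`IsMildSolution.energy_le`).

Everything is done with weak derivatives in L²: identities and inequalities pass from test functions
to limits of jets, and the algebraic positivity conditions pass to L²-valued arguments by
coordinates in a finite-dimensional span. -/

instance : CompleteSpace (H01 Ω) :=
  (Submodule.isClosed_topologicalClosure (LinearMap.range (jet1 Ω))).completeSpace_coe

instance : CompleteSpace (H02 Ω) :=
  (Submodule.isClosed_topologicalClosure (LinearMap.range (jet2 Ω))).completeSpace_coe

/-! ### Test functions -/

theorem pd_apply (K : Fin d) (φ : 𝓓(Ω, ℝ)) (x : Space d) :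
    pd K φ x = fderiv ℝ φ x (EuclideanSpace.single K (1 : ℝ)) := by
  have h := TestFunction.fderivCLM_apply_of_le (𝕜 := ℝ) (n := ⊤) (k := ⊤) φ le_rfl
  exact congrArg (fun T => T x (EuclideanSpace.single K (1 : ℝ))) h

theorem pd_comm (K L : Fin d) (φ : 𝓓(Ω, ℝ)) : pd K (pd L φ) = pd L (pd K φ) := by
  have key : ∀ (K L : Fin d) (x : Space d), pd K (pd L φ) x =
      fderiv ℝ (fderiv ℝ φ) x (EuclideanSpace.single K (1 : ℝ)) (EuclideanSpace.single L 1) := by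
    intro K L x
    have hL : (pd L φ : Space d → ℝ) = fun y => fderiv ℝ φ y (EuclideanSpace.single L (1 : ℝ)) :=
      funext (pd_apply L φ)
    have hd : DifferentiableAt ℝ (fderiv ℝ φ) x :=
      ((φ.contDiff.of_le (m := 2) (WithTop.coe_le_coe.2 (le_top (a := (2 : ℕ∞))))).fderiv_right (m := 1)
        le_rfl).differentiable one_ne_zero x
    rw [pd_apply, hL, fderiv_clm_apply hd (differentiableAt_const _)]
    simp
  ext x
  rw [key, key]
  have h := ((φ.contDiff.of_le (m := 2) (WithTop.coe_le_coe.2 (le_top (a := (2 : ℕ∞))))).contDiffAt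
    (x := x)).isSymmSndFDerivAt (by simp)
  exact h _ _

theorem inner_toL2 (f g : 𝓓(Ω, ℝ)) : ⟪toL2 f, toL2 g⟫_ℝ = ∫ x : Space d, f x * g x := by
  have h1 : ⟪toL2 f, toL2 g⟫_ℝ = ∫ x in (Ω : Set (Space d)), f x * g x := by
    rw [L2.inner_def]
    refine integral_congr_ae ?_
    filter_upwards [(memLp_testFunction f).coeFn_toLp, (memLp_testFunction g).coeFn_toLp]
      with x hf hg
    change ⟪((memLp_testFunction f).toLp f : Space d → ℝ) x,
      ((memLp_testFunction g).toLp g : Space d → ℝ) x⟫_ℝ = _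
    rw [hf, hg]
    simp [mul_comm]
  rw [h1]
  refine setIntegral_eq_integral_of_forall_compl_eq_zero fun x hx => ?_
  have : g x = 0 := by
    by_contra h
    exact hx (g.tsupport_subset (subset_tsupport _ h))
  simp [this]

theorem norm_toL2_sq (f : 𝓓(Ω, ℝ)) : ‖toL2 f‖ ^ 2 = ∫ x : Space d, f x ^ 2 := by
  rw [← real_inner_self_eq_norm_sq, inner_toL2]
  simp only [sq]

/-- Poincaré's inequality for test functions on a domain contained in the slab `|x_K| ≤ R`. -/
theorem norm_toL2_sq_le {R : ℝ} (K : Fin d) (hR : ∀ x ∈ Ω, |x K| ≤ R) (φ : 𝓓(Ω, ℝ)) :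
    ‖toL2 φ‖ ^ 2 ≤ 4 * R ^ 2 * ‖toL2 (pd K φ)‖ ^ 2 := by
  have hx : ∀ x : Space d, HasFDerivAt (fun y : Space d => y K)
      (EuclideanSpace.proj K : Space d →L[ℝ] ℝ) x := fun x =>
    (EuclideanSpace.proj K : Space d →L[ℝ] ℝ).hasFDerivAt
  have hφ : ∀ x : Space d, DifferentiableAt ℝ φ x := fun x =>
    (φ.contDiff.differentiable (by simp)) x
  have hxφ : ∀ x : Space d, fderiv ℝ (fun y : Space d => y K * φ y) x
      (EuclideanSpace.single K (1 : ℝ)) = φ x + x K * pd K φ x := by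
    intro x
    have h : HasFDerivAt (fun y : Space d => y K * φ y) _ x := (hx x).mul (hφ x).hasFDerivAt
    rw [h.fderiv, pd_apply]
    simp [add_comm]
  have hcK : Continuous fun y : Space d => y K := by fun_prop
  have hint : ∀ (q : Space d → ℝ) (f g : 𝓓(Ω, ℝ)), Continuous q →
      Integrable (fun x : Space d => q x * f x * g x) := fun q f g hq =>
    ((hq.mul f.continuous).mul g.continuous).integrable_of_hasCompactSupport
      g.hasCompactSupport.mul_left
  have i1 := hint (fun _ => 1) φ φ continuous_const
  have i2 := hint _ φ (pd K φ) hcK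
  have i3 := hint _ (pd K φ) φ hcK
  have i4 := hint (fun _ => 1) (pd K φ) (pd K φ) continuous_const
  have i5 := hint _ φ φ hcK
  simp only [one_mul, ← sq] at i1 i4
  -- Integrating by parts with x_K φ against φ_{,K} gives, together with `hcomm`, ∫ φ² = -2 ∫ x_K φ
  -- φ_{,K}.
  have hib : ∫ x : Space d, x K * φ x * pd K φ x
      = -∫ x : Space d, (φ x ^ 2 + x K * pd K φ x * φ x) := by
    have h := integral_mul_fderiv_eq_neg_fderiv_mul_of_integrable (μ := volume)
      (f := fun x : Space d => x K * φ x) (g := φ) (v := EuclideanSpace.single K (1 : ℝ))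
      (by
        simp only [hxφ]
        refine (i1.add i3).congr (Filter.Eventually.of_forall fun x => ?_)
        simp only [Pi.add_apply]; ring)
      (by simpa only [← pd_apply] using i2) i5
      (fun x _ => (hx x).differentiableAt.mul (hφ x)) (fun x _ => hφ x)
    simp only [hxφ, ← pd_apply] at h
    rw [h]
    congr 2 with x
    ring
  rw [integral_add i1 i3] at hib
  have hcomm : ∫ x : Space d, x K * pd K φ x * φ x = ∫ x : Space d, x K * φ x * pd K φ x := by
    congr with x; ring
  -- Young's inequality with weight 1/2 on φ², so that half of ∫ φ² can be absorbed; this produces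
  -- the constant 4R². The bound on x_K is needed only where φ does not vanish.
  have hle : ∫ x : Space d, -2 * (x K * φ x * pd K φ x)
      ≤ ∫ x : Space d, (1 / 2 * φ x ^ 2 + 2 * R ^ 2 * pd K φ x ^ 2) := by
    refine integral_mono (i2.const_mul _) ((i1.const_mul _).add (i4.const_mul _)) fun x => ?_
    by_cases hxΩ : x ∈ Ω
    · have h1 : (x K) ^ 2 ≤ R ^ 2 := sq_le_sq.2 ((hR x hxΩ).trans (le_abs_self R))
      have h2 := mul_le_mul_of_nonneg_right h1 (sq_nonneg (pd K φ x))
      have h3 := sq_nonneg (φ x + 2 * (x K * pd K φ x))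
      simp only
      nlinarith
    · have h0 : φ x = 0 := by
        by_contra h
        exact hxΩ (φ.tsupport_subset (subset_tsupport _ h))
      simp only [h0]
      have : 0 ≤ 2 * R ^ 2 * pd K φ x ^ 2 := by positivity
      linarith
  rw [integral_const_mul, integral_add (i1.const_mul _) (i4.const_mul _), integral_const_mul,
    integral_const_mul] at hle
  rw [norm_toL2_sq, norm_toL2_sq]
  linarith

/-! ### Density of test functions -/

/-- Elements are limits of jets of test functions, so a closed condition need only be checked on
jets. This carries over Poincaré's inequality and integration by parts, and enlarges the class of
admissible multipliers in the equations. -/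
theorem H01_closure_induction {P : L2 Ω × (Fin d → L2 Ω) → Prop} (hP : IsClosed {w | P w})
    (h : ∀ φ : 𝓓(Ω, ℝ), P (toL2 φ, fun K => toL2 (pd K φ))) (w : H01 Ω) : P w.1 := by
  have hw := SetLike.mem_coe.2 (show w.1 ∈ (LinearMap.range (jet1 Ω)).topologicalClosure from w.2)
  rw [Submodule.topologicalClosure_coe] at hw
  refine closure_minimal (s := (LinearMap.range (jet1 Ω) : Set _)) ?_ hP hw
  rintro _ ⟨φ, rfl⟩
  exact h φ

theorem H02_closure_induction {P : L2 Ω × (Fin d → L2 Ω) × (Fin d → Fin d → L2 Ω) → Prop}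
    (hP : IsClosed {w | P w})
    (h : ∀ φ : 𝓓(Ω, ℝ), P (toL2 φ, fun K => toL2 (pd K φ), fun K L => toL2 (pd L (pd K φ))))
    (w : H02 Ω) : P w.1 := by
  have hw := SetLike.mem_coe.2 (show w.1 ∈ (LinearMap.range (jet2 Ω)).topologicalClosure from w.2)
  rw [Submodule.topologicalClosure_coe] at hw
  refine closure_minimal (s := (LinearMap.range (jet2 Ω) : Set _)) ?_ hP hw
  rintro _ ⟨φ, rfl⟩
  exact h φ

/-- Schwarz's theorem survives L² limits. It is needed because the positivity condition on C, M, K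
covers only H symmetric in its last two indices. -/
theorem H02_symm (w : H02 Ω) (K L : Fin d) : w.1.2.2 K L = w.1.2.2 L K := by
  refine H02_closure_induction (P := fun w => w.2.2 K L = w.2.2 L K)
    (isClosed_eq (by fun_prop) (by fun_prop)) (fun φ => ?_) w
  simp only [pd_comm K L φ]

/-- Integration by parts for `w ∈ H²₀(Ω)` and `z ∈ H¹₀(Ω)`. -/
theorem H02_inner_H01 (w : H02 Ω) (z : H01 Ω) (K : Fin d) :
    ⟪w.1.2.1 K, z.1.1⟫_ℝ = -⟪w.1.1, z.1.2 K⟫_ℝ :=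
  H01_closure_induction (P := fun z => ⟪w.1.2.1 K, z.1⟫_ℝ = -⟪w.1.1, z.2 K⟫_ℝ)
    (isClosed_eq (by fun_prop) (by fun_prop)) (fun φ => H02_weakDeriv w K φ) z

theorem H01_poincare {R : ℝ} (K : Fin d) (hR : ∀ x ∈ Ω, |x K| ≤ R) (w : H01 Ω) :
    ‖w.1.1‖ ^ 2 ≤ 4 * R ^ 2 * ‖w.1.2 K‖ ^ 2 :=
  H01_closure_induction (P := fun w => ‖w.1‖ ^ 2 ≤ 4 * R ^ 2 * ‖w.2 K‖ ^ 2)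
    (isClosed_le (by fun_prop) (by fun_prop)) (fun φ => norm_toL2_sq_le K hR φ) w

theorem H02_poincare {R : ℝ} (K : Fin d) (hR : ∀ x ∈ Ω, |x K| ≤ R) (w : H02 Ω) :
    ‖w.1.1‖ ^ 2 ≤ 4 * R ^ 2 * ‖w.1.2.1 K‖ ^ 2 :=
  H02_closure_induction (P := fun w => ‖w.1‖ ^ 2 ≤ 4 * R ^ 2 * ‖w.2.1 K‖ ^ 2)
    (isClosed_le (by fun_prop) (by fun_prop)) (fun φ => norm_toL2_sq_le K hR φ) w

namespace State

/-- Poincaré's inequality for the components `u_i` and `τ` of a state. -/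
theorem exists_poincare (hd : 0 < d) (hΩ : Bornology.IsBounded (Ω : Set (Space d))) :
    ∃ c : ℝ, 0 < c ∧ ∀ U : State Ω, (∑ i, ‖U.u i‖ ^ 2 ≤ c * ∑ i, ∑ K, ‖U.du i K‖ ^ 2) ∧
      ‖U.τ‖ ^ 2 ≤ c * ∑ K, ‖U.dτ K‖ ^ 2 := by
  obtain ⟨R, hR0, hR⟩ := hΩ.exists_pos_norm_le
  -- A slab in a single direction suffices; d > 0 provides one.
  have hR' : ∀ x ∈ Ω, |x ⟨0, hd⟩| ≤ R := fun x hx => by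
    have := PiLp.norm_apply_le x (⟨0, hd⟩ : Fin d)
    exact this.trans (hR x hx)
  refine ⟨4 * R ^ 2, by positivity, fun U => ⟨?_, ?_⟩⟩
  · rw [Finset.mul_sum]
    refine Finset.sum_le_sum fun i _ => (H02_poincare _ hR' (U.1 i)).trans ?_
    gcongr
    exact Finset.single_le_sum (f := fun K => ‖U.du i K‖ ^ 2) (fun _ _ => by positivity)
      (Finset.mem_univ _)
  · refine (H01_poincare _ hR' U.2.2.1).trans ?_
    gcongr
    exact Finset.single_le_sum (f := fun K => ‖U.dτ K‖ ^ 2) (fun _ _ => by positivity)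
      (Finset.mem_univ _)

theorem ddu_symm (U : State Ω) (i K L : Fin d) : U.ddu i K L = U.ddu i L K :=
  H02_symm (U.1 i) K L

end State

/-! ### Quadratic forms with values in a Hilbert space -/

section Hilbert

variable {H : Type*} [NormedAddCommGroup H] [InnerProductSpace ℝ H]

/-- Finitely many vectors have coordinates in an orthonormal basis of their span. -/
theorem exists_coordinates {ι : Type*} [Finite ι] (f : ι → H) :
    ∃ (n : ℕ) (e : Fin n → H), ∀ i j, ⟪f i, f j⟫_ℝ = ∑ b, ⟪e b, f i⟫_ℝ * ⟪e b, f j⟫_ℝ := by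
  let S := Submodule.span ℝ (Set.range f)
  have : FiniteDimensional ℝ S := FiniteDimensional.span_of_finite ℝ (Set.finite_range f)
  let b := stdOrthonormalBasis ℝ S
  refine ⟨_, fun k => (b k : H), fun i j => ?_⟩
  have hf : ∀ i, f i ∈ S := fun i => Submodule.subset_span ⟨i, rfl⟩
  have h := b.sum_inner_mul_inner ⟨f i, hf i⟩ ⟨f j, hf j⟩
  simp only [Submodule.coe_inner] at h
  rw [← h]
  exact Finset.sum_congr rfl fun k _ => by rw [real_inner_comm]

/-- A mixed bilinear expression is controlled by an arbitrarily small multiple of one family and a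
large multiple of the other. -/
theorem exists_abs_sum_inner_le {ι κ : Type*} [Fintype ι] [Fintype κ] (c : ι → κ → ℝ) {ε : ℝ}
    (hε : 0 < ε) : ∃ k : ℝ, 0 ≤ k ∧ ∀ (x : ι → H) (y : κ → H),
      |∑ i, ∑ j, c i j * ⟪x i, y j⟫_ℝ| ≤ ε * ∑ i, ‖x i‖ ^ 2 + k * ∑ j, ‖y j‖ ^ 2 := by
  set s := ∑ i, ∑ j, |c i j| with hs
  have hs0 : 0 ≤ s := by positivity
  -- The constant that completes the square in sXY ≤ εX² + s²/(4ε) Y².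
  refine ⟨s ^ 2 / (4 * ε), by positivity, fun x y => ?_⟩
  set X := √(∑ i, ‖x i‖ ^ 2) with hX
  set Y := √(∑ j, ‖y j‖ ^ 2) with hY
  have hx : ∀ i, ‖x i‖ ≤ X := fun i => Real.le_sqrt_of_sq_le
    (Finset.single_le_sum (f := fun i => ‖x i‖ ^ 2) (fun _ _ => by positivity) (Finset.mem_univ i))
  have hy : ∀ j, ‖y j‖ ≤ Y := fun j => Real.le_sqrt_of_sq_le
    (Finset.single_le_sum (f := fun j => ‖y j‖ ^ 2) (fun _ _ => by positivity) (Finset.mem_univ j))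
  have h1 : |∑ i, ∑ j, c i j * ⟪x i, y j⟫_ℝ| ≤ s * (X * Y) := by
    rw [hs, Finset.sum_mul]
    refine (Finset.abs_sum_le_sum_abs _ _).trans (Finset.sum_le_sum fun i _ => ?_)
    rw [Finset.sum_mul]
    refine (Finset.abs_sum_le_sum_abs _ _).trans (Finset.sum_le_sum fun j _ => ?_)
    rw [abs_mul]
    refine mul_le_mul_of_nonneg_left ((abs_real_inner_le_norm _ _).trans ?_) (abs_nonneg _)
    exact mul_le_mul (hx i) (hy j) (norm_nonneg _) (Real.sqrt_nonneg _)
  have hX2 : ∑ i, ‖x i‖ ^ 2 = X ^ 2 := (Real.sq_sqrt (by positivity)).symm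
  have hY2 : ∑ j, ‖y j‖ ^ 2 = Y ^ 2 := (Real.sq_sqrt (by positivity)).symm
  rw [hX2, hY2]
  refine h1.trans ?_
  have h2 : ε * X ^ 2 + s ^ 2 / (4 * ε) * Y ^ 2 - s * (X * Y)
      = (2 * ε * X - s * Y) ^ 2 / (4 * ε) := by
    field_simp
    ring
  have h3 : 0 ≤ (2 * ε * X - s * Y) ^ 2 / (4 * ε) := by positivity
  linarith

end Hilbert

namespace State

variable (U : State Ω)

/-- `‖v‖²` -/
def normSqV : ℝ := ∑ i, ‖U.v i‖ ^ 2

/-- `‖∇u‖²` -/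
def normSqDu : ℝ := ∑ i, ∑ K, ‖U.du i K‖ ^ 2

/-- `‖∇τ‖²` -/
def normSqDτ : ℝ := ∑ K, ‖U.dτ K‖ ^ 2

theorem normSqV_nonneg : 0 ≤ U.normSqV := Finset.sum_nonneg fun _ _ => by positivity

theorem normSqDu_nonneg : 0 ≤ U.normSqDu :=
  Finset.sum_nonneg fun _ _ => Finset.sum_nonneg fun _ _ => by positivity

theorem normSqDτ_nonneg : 0 ≤ U.normSqDτ := Finset.sum_nonneg fun _ _ => by positivity

end State

/-! ### Coercivity -/

/-- In an orthonormal basis of the span of the vectors, both sides are sums over coordinates, and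
the scalar hypothesis holds coordinate by coordinate. The coercivity lemmas for A and for C, M, K
use the same device. -/
theorem sum_sq_le_of_matrix_posDef {α : ℝ} {N : Fin d → Fin d → ℝ}
    (h : ∀ ξ : Fin d → ℝ, α * ∑ i, ξ i ^ 2 ≤ ∑ i, ∑ j, N i j * ξ i * ξ j) (f : Fin d → L2 Ω) :
    α * ∑ i, ‖f i‖ ^ 2 ≤ ∑ i, ∑ j, N i j * ⟪f j, f i⟫_ℝ := by
  obtain ⟨n, e, he⟩ := exists_coordinates f
  simp only [← real_inner_self_eq_norm_sq, he, Finset.mul_sum]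
  have h' := Finset.sum_le_sum fun (b : Fin n) (_ : b ∈ Finset.univ) => h fun i => ⟪e b, f i⟫_ℝ
  simp only [Finset.mul_sum] at h'
  rw [Finset.sum_comm]
  refine (le_of_eq ?_).trans (h'.trans (le_of_eq ?_))
  · simp only [sq]
  · rw [Finset.sum_comm]
    refine Finset.sum_congr rfl fun i _ => ?_
    rw [Finset.sum_comm]
    exact Finset.sum_congr rfl fun j _ => Finset.sum_congr rfl fun b _ => by ring

theorem Coeffs.PosA.exists_le (hA : p.PosA) : ∃ α : ℝ, 0 < α ∧ ∀ U : State Ω,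
    α * U.normSqDu ≤ ∑ i, ∑ K, ∑ L, ∑ j, p.A i K L j * ⟪U.du i K, U.du j L⟫_ℝ := by
  obtain ⟨α, hα, h⟩ := hA
  refine ⟨α, hα, fun U => ?_⟩
  obtain ⟨n, e, he⟩ := exists_coordinates fun iK : Fin d × Fin d => U.du iK.1 iK.2
  have he' : ∀ i K j L, ⟪U.du i K, U.du j L⟫_ℝ =
      ∑ b, ⟪e b, U.du i K⟫_ℝ * ⟪e b, U.du j L⟫_ℝ := fun i K j L => he (i, K) (j, L)
  have h' := Finset.sum_le_sum fun (b : Fin n) (_ : b ∈ Finset.univ) =>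
    h fun i K => ⟪e b, U.du i K⟫_ℝ
  simp only [State.normSqDu, ← real_inner_self_eq_norm_sq, he']
  refine (le_of_eq ?_).trans (h'.trans (le_of_eq ?_))
  · rw [← Finset.mul_sum]
    simp only [sq, Finset.sum_comm (s := (Finset.univ : Finset (Fin n)))]
  · simp only [Finset.sum_comm (s := (Finset.univ : Finset (Fin n))), Finset.mul_sum, mul_assoc]

theorem Coeffs.PosCMK.exists_le (h : p.PosCMK) : ∃ α : ℝ, 0 < α ∧ ∀ U : State Ω,
    α * U.normSqDτ ≤
      (∑ i, ∑ I, ∑ J, ∑ K, ∑ L, ∑ j, p.C i I J K L j * ⟪U.ddu i J I, U.ddu j L K⟫_ℝ)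
      + (∑ I, ∑ J, p.K I J * ⟪U.dτ I, U.dτ J⟫_ℝ)
      + 2 * ∑ i, ∑ J, ∑ K, ∑ L, p.M i J K L * ⟪U.ddu i K J, U.dτ L⟫_ℝ := by
  obtain ⟨α, hα, h⟩ := h
  refine ⟨α, hα, fun U => ?_⟩
  -- One basis for second derivatives of u and gradient of τ together, so that the mixed M-terms
  -- split over the same coordinates.
  obtain ⟨n, e, he⟩ := exists_coordinates
    (Sum.elim (fun x : Fin d × Fin d × Fin d => U.ddu x.1 x.2.1 x.2.2) (fun K : Fin d => U.dτ K))
  have he1 : ∀ i I J j K L, ⟪U.ddu i J I, U.ddu j L K⟫_ℝ =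
      ∑ b, ⟪e b, U.ddu i J I⟫_ℝ * ⟪e b, U.ddu j L K⟫_ℝ := fun i I J j K L =>
    he (.inl (i, J, I)) (.inl (j, L, K))
  have he2 : ∀ i J K L, ⟪U.ddu i K J, U.dτ L⟫_ℝ =
      ∑ b, ⟪e b, U.ddu i K J⟫_ℝ * ⟪e b, U.dτ L⟫_ℝ := fun i J K L =>
    he (.inl (i, K, J)) (.inr L)
  have he3 : ∀ I J, ⟪U.dτ I, U.dτ J⟫_ℝ =
      ∑ b, ⟪e b, U.dτ I⟫_ℝ * ⟪e b, U.dτ J⟫_ℝ := fun I J => he (.inr I) (.inr J)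
  have h' := Finset.sum_le_sum fun (b : Fin n) (_ : b ∈ Finset.univ) =>
    h (fun i J K => ⟪e b, U.ddu i J K⟫_ℝ) (fun K => ⟪e b, U.dτ K⟫_ℝ)
      fun i J K => by rw [U.ddu_symm i J K]
  -- The second derivatives of u are discarded: every term to be absorbed later involves at most ∇u
  -- and ∇τ.
  have h'' : ∀ b : Fin n, α * ∑ R, ⟪e b, U.dτ R⟫_ℝ ^ 2 ≤
      α * (∑ R, ⟪e b, U.dτ R⟫_ℝ ^ 2 + ∑ k, ∑ S, ∑ T, ⟪e b, U.ddu k S T⟫_ℝ ^ 2) := fun b => by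
    have : 0 ≤ ∑ k, ∑ S, ∑ T, ⟪e b, U.ddu k S T⟫_ℝ ^ 2 := by positivity
    gcongr
    linarith
  have hM : ∀ b : Fin n, (∑ j, ∑ L, ∑ K, ∑ I, p.M j L K I * ⟪e b, U.ddu j L K⟫_ℝ * ⟪e b, U.dτ I⟫_ℝ)
      = ∑ i, ∑ J, ∑ K, ∑ L, p.M i J K L * ⟪e b, U.ddu i K J⟫_ℝ * ⟪e b, U.dτ L⟫_ℝ := fun b =>
    Finset.sum_congr rfl fun i _ => Finset.sum_congr rfl fun J _ => Finset.sum_congr rfl fun K _ =>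
      Finset.sum_congr rfl fun L _ => by rw [U.ddu_symm i J K]
  simp only [hM] at h'
  replace h' := (Finset.sum_le_sum fun b _ => h'' b).trans h'
  simp only [State.normSqDτ, ← real_inner_self_eq_norm_sq, he1, he2, he3]
  refine (le_of_eq ?_).trans (h'.trans (le_of_eq ?_))
  · rw [← Finset.mul_sum]
    simp only [sq, Finset.sum_comm (s := (Finset.univ : Finset (Fin n)))]
  · simp only [Finset.sum_add_distrib, Finset.sum_comm (s := (Finset.univ : Finset (Fin n))),
      Finset.mul_sum, mul_assoc, two_mul]
    ring

/-! ### The energy -/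

theorem energy_eq_form (p : Coeffs d) (U : State Ω) : energy p U = 1 / 2 * form p U U := by
  have hK : ∑ I, ∑ J, p.K I J * ⟪U.dτ J, U.dτ I⟫_ℝ = ∑ I, ∑ J, p.K I J * ⟪U.dτ I, U.dτ J⟫_ℝ := by
    simp only [real_inner_comm]
  simp only [energy, form, hK]
  ring

theorem exists_energy_ge (hρ : 0 < p.ρ) (ha : 0 < p.a) (hA : p.PosA) (hCMK : p.PosCMK) :
    ∃ α : ℝ, 0 < α ∧ ∀ U : State Ω,
      α * (U.normSqV + ‖U.θ‖ ^ 2 + U.normSqDu + U.normSqDτ) ≤ energy p U := by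
  obtain ⟨α₁, h₁, hA⟩ := hA.exists_le (Ω := Ω)
  obtain ⟨α₂, h₂, hCMK⟩ := hCMK.exists_le (Ω := Ω)
  obtain ⟨α, hα, hαρ, hαa, hα₁, hα₂⟩ : ∃ α : ℝ, 0 < α ∧ α ≤ p.ρ ∧ α ≤ p.a ∧ α ≤ α₁ ∧ α ≤ α₂ :=
    ⟨min (min p.ρ p.a) (min α₁ α₂), by positivity,
      (min_le_left _ _).trans (min_le_left _ _), (min_le_left _ _).trans (min_le_right _ _),
      (min_le_right _ _).trans (min_le_left _ _), (min_le_right _ _).trans (min_le_right _ _)⟩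
  refine ⟨α / 2, by positivity, fun U => ?_⟩
  have hv : ∑ i, ⟪U.v i, U.v i⟫_ℝ = U.normSqV := by
    simp only [real_inner_self_eq_norm_sq, State.normSqV]
  have e₁ := mul_le_mul_of_nonneg_right hαρ U.normSqV_nonneg
  have e₂ := mul_le_mul_of_nonneg_right hαa (sq_nonneg ‖U.θ‖)
  have e₃ := (mul_le_mul_of_nonneg_right hα₁ U.normSqDu_nonneg).trans (hA U)
  have e₄ := (mul_le_mul_of_nonneg_right hα₂ U.normSqDτ_nonneg).trans (hCMK U)
  rw [energy, hv, real_inner_self_eq_norm_sq]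
  linarith

/-! ### Consequences of the equations -/

namespace InGenerator

variable {U F : State Ω}

/-- Both sides are continuous in the second order jet, so the distributional equation extends by
density. This makes u_i and v_i admissible multipliers. -/
theorem snd_H02 (h : InGenerator p U F) (i : Fin d) (w : H02 Ω) :
    p.ρ * ⟪F.v i, w.1.1⟫_ℝ =
      -(∑ J, ∑ K, ∑ j, p.A i J K j * ⟪U.du j K, w.1.2.1 J⟫_ℝ)
      + (∑ J, p.β J i * ⟪U.θ, w.1.2.1 J⟫_ℝ)
      - (∑ J, ∑ K, ∑ L, ∑ I, ∑ j, p.C i J K L I j * ⟪U.ddu j I L, w.1.2.2 K J⟫_ℝ)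
      - (∑ J, ∑ K, ∑ L, p.M i J K L * ⟪U.dτ L, w.1.2.2 K J⟫_ℝ)
      - ∑ j, p.E i j * ⟪U.v j, w.1.1⟫_ℝ :=
  H02_closure_induction (P := fun w => p.ρ * ⟪F.v i, w.1⟫_ℝ =
      -(∑ J, ∑ K, ∑ j, p.A i J K j * ⟪U.du j K, w.2.1 J⟫_ℝ)
      + (∑ J, p.β J i * ⟪U.θ, w.2.1 J⟫_ℝ)
      - (∑ J, ∑ K, ∑ L, ∑ I, ∑ j, p.C i J K L I j * ⟪U.ddu j I L, w.2.2 K J⟫_ℝ)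
      - (∑ J, ∑ K, ∑ L, p.M i J K L * ⟪U.dτ L, w.2.2 K J⟫_ℝ)
      - ∑ j, p.E i j * ⟪U.v j, w.1⟫_ℝ)
    (isClosed_eq (by fun_prop) (by fun_prop)) (h.snd i) w

theorem fth_H01 (h : InGenerator p U F) (w : H01 Ω) :
    p.a * ⟪F.θ, w.1.1⟫_ℝ =
      -(∑ K, ∑ i, p.β K i * ⟪F.du i K, w.1.1⟫_ℝ)
      - (∑ I, ∑ J, p.m I J * ⟪F.dτ J, w.1.2 I⟫_ℝ)
      - (∑ j, ∑ L, ∑ K, ∑ I, p.M j L K I * ⟪U.ddu j L K, w.1.2 I⟫_ℝ)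
      - ∑ I, ∑ J, p.K I J * ⟪U.dτ J, w.1.2 I⟫_ℝ :=
  H01_closure_induction (P := fun w => p.a * ⟪F.θ, w.1⟫_ℝ =
      -(∑ K, ∑ i, p.β K i * ⟪F.du i K, w.1⟫_ℝ)
      - (∑ I, ∑ J, p.m I J * ⟪F.dτ J, w.2 I⟫_ℝ)
      - (∑ j, ∑ L, ∑ K, ∑ I, p.M j L K I * ⟪U.ddu j L K, w.2 I⟫_ℝ)
      - ∑ I, ∑ J, p.K I J * ⟪U.dτ J, w.2 I⟫_ℝ)
    (isClosed_eq (by fun_prop) (by fun_prop)) h.fth w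

/-- The weak form of the whole system, tested with a state `W`. -/
theorem weak_form (h : InGenerator p U F) (W : State Ω) :
    p.ρ * (∑ i, ⟪F.v i, W.u i⟫_ℝ) + p.a * ⟪F.θ, W.τ⟫_ℝ =
      -(∑ i, ∑ K, ∑ L, ∑ j, p.A i K L j * ⟪W.du i K, U.du j L⟫_ℝ)
      - (∑ i, ∑ I, ∑ J, ∑ K, ∑ L, ∑ j, p.C i I J K L j * ⟪W.ddu i J I, U.ddu j L K⟫_ℝ)
      - (∑ I, ∑ J, p.K I J * ⟪U.dτ J, W.dτ I⟫_ℝ)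
      - (∑ i, ∑ J, ∑ K, ∑ L, p.M i J K L * ⟪W.ddu i K J, U.dτ L⟫_ℝ)
      - (∑ j, ∑ L, ∑ K, ∑ I, p.M j L K I * ⟪U.ddu j K L, W.dτ I⟫_ℝ)
      + (∑ i, ∑ J, p.β J i * ⟪U.θ, W.du i J⟫_ℝ)
      - (∑ i, ∑ J, p.β J i * ⟪F.du i J, W.τ⟫_ℝ)
      - (∑ i, ∑ j, p.E i j * ⟪U.v j, W.u i⟫_ℝ)
      - ∑ I, ∑ J, p.m I J * ⟪F.dτ J, W.dτ I⟫_ℝ := by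
  have h₂ : ∑ i, p.ρ * ⟪F.v i, W.u i⟫_ℝ = ∑ i,
      (-(∑ J, ∑ K, ∑ j, p.A i J K j * ⟪W.du i J, U.du j K⟫_ℝ)
      + (∑ J, p.β J i * ⟪U.θ, W.du i J⟫_ℝ)
      - (∑ J, ∑ K, ∑ L, ∑ I, ∑ j, p.C i J K L I j * ⟪W.ddu i K J, U.ddu j I L⟫_ℝ)
      - (∑ J, ∑ K, ∑ L, p.M i J K L * ⟪W.ddu i K J, U.dτ L⟫_ℝ)
      - ∑ j, p.E i j * ⟪U.v j, W.u i⟫_ℝ) := by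
    refine Finset.sum_congr rfl fun i _ => (h.snd_H02 i (W.1 i)).trans ?_
    simp only [real_inner_comm (U.du _ _) (W.du i _), real_inner_comm (U.ddu _ _ _) (W.ddu i _ _),
      real_inner_comm (U.dτ _) (W.ddu i _ _)]
    rfl
  have h₄ : p.a * ⟪F.θ, W.τ⟫_ℝ = _ := h.fth_H01 W.2.2.1
  have hM : (∑ j, ∑ L, ∑ K, ∑ I, p.M j L K I * ⟪U.ddu j L K, W.dτ I⟫_ℝ) =
      ∑ j, ∑ L, ∑ K, ∑ I, p.M j L K I * ⟪U.ddu j K L, W.dτ I⟫_ℝ :=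
    Finset.sum_congr rfl fun j _ => Finset.sum_congr rfl fun L _ => Finset.sum_congr rfl fun K _ =>
      Finset.sum_congr rfl fun I _ => by rw [U.ddu_symm j K L]
  have hβ : (∑ K, ∑ i, p.β K i * ⟪F.du i K, W.τ⟫_ℝ) = ∑ i, ∑ J, p.β J i * ⟪F.du i J, W.τ⟫_ℝ :=
    Finset.sum_comm
  simp only [Finset.sum_add_distrib, Finset.sum_sub_distrib, Finset.sum_neg_distrib] at h₂
  rw [Finset.mul_sum, h₂, h₄, ← hM, ← hβ]
  simp only [State.τ, State.dτ]
  ring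

/-- The gradient of `v` tested with `τ`. -/
theorem inner_du_τ (h : InGenerator p U F) (W : State Ω) (i K : Fin d) :
    ⟪F.du i K, W.τ⟫_ℝ = -⟪U.v i, W.dτ K⟫_ℝ :=
  (H02_inner_H01 (F.1 i) W.2.2.1 K).trans (by rw [← h.fst i]; rfl)

/-- The multiplier identity obtained by testing the system with `(u, τ)`. -/
theorem multiplier (h : InGenerator p U F) :
    p.ρ * (∑ i, (⟪F.u i, U.v i⟫_ℝ + ⟪U.u i, F.v i⟫_ℝ))
        + p.a * (⟪F.τ, U.θ⟫_ℝ + ⟪U.τ, F.θ⟫_ℝ) =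
      -2 * energy p U + 2 * p.ρ * U.normSqV + 2 * p.a * ‖U.θ‖ ^ 2
      + (∑ i, ∑ J, p.β J i * ⟪U.θ, U.du i J⟫_ℝ)
      + (∑ i, ∑ J, p.β J i * ⟪U.v i, U.dτ J⟫_ℝ)
      - (∑ i, ∑ j, p.E i j * ⟪U.u i, U.v j⟫_ℝ)
      - ∑ I, ∑ J, p.m I J * ⟪U.dτ I, F.dτ J⟫_ℝ := by
  -- The dissipation controls v but not ∇v, so the derivative in the β-term is moved onto τ by
  -- `inner_du_τ`.
  have hw := h.weak_form U
  simp only [h.inner_du_τ, mul_neg, Finset.sum_neg_distrib, real_inner_comm (U.u _),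
    real_inner_comm U.τ] at hw
  have hm : ∑ I, ∑ J, p.m I J * ⟪U.dτ I, F.dτ J⟫_ℝ = ∑ I, ∑ J, p.m I J * ⟪F.dτ J, U.dτ I⟫_ℝ := by
    simp only [real_inner_comm]
  simp only [energy_eq_form, form, h.fst, h.trd, Finset.sum_add_distrib,
    real_inner_self_eq_norm_sq, State.normSqV, hm]
  linarith

/-- The system is tested with `F`, whose u- and τ-components are v and θ. The two β-terms then
cancel, the conservative terms reassemble into the form, and only the damping remains. -/
theorem form_self_eq (hsymm : ∀ U V : State Ω, form p U V = form p V U)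
    (h : InGenerator p U F) :
    form p F U = -(∑ i, ∑ j, p.E i j * ⟪U.v j, U.v i⟫_ℝ)
      - ∑ I, ∑ J, p.m I J * ⟪F.dτ J, F.dτ I⟫_ℝ := by
  have hw := h.weak_form F
  have hK : ∑ I, ∑ J, p.K I J * ⟪U.dτ J, F.dτ I⟫_ℝ = ∑ I, ∑ J, p.K I J * ⟪F.dτ J, U.dτ I⟫_ℝ := by
    -- On states with only a τ-component the form reduces to its K-part, which is therefore
    -- symmetric.
    have hs := hsymm (0, 0, U.2.2.1, 0) (0, 0, F.2.2.1, 0)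
    simpa [form, State.v, State.θ, State.du, State.ddu, State.dτ] using hs
  have hβ : ∑ i, ∑ J, p.β J i * ⟪F.du i J, U.θ⟫_ℝ = ∑ i, ∑ J, p.β J i * ⟪U.θ, F.du i J⟫_ℝ := by
    simp only [real_inner_comm]
  simp only [h.fst, h.trd, hK, hβ] at hw
  rw [form]
  linarith

end InGenerator

/-! ### The Lyapunov functional -/

/-- The lower order part `∫ (ρ u_i v_i + a τ θ) dx` of the Lyapunov functional. -/
def mixed (p : Coeffs d) (U : State Ω) : ℝ :=
  p.ρ * (∑ i, ⟪U.u i, U.v i⟫_ℝ) + p.a * ⟪U.τ, U.θ⟫_ℝ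

/-- Poincaré bounds u and τ by their gradients, which the energy controls. Hence adding `mixed` to a
large multiple of the energy keeps it equivalent to the energy. -/
theorem exists_abs_mixed_le (hd : 0 < d) (hΩ : Bornology.IsBounded (Ω : Set (Space d)))
    (hρ : 0 < p.ρ) (ha : 0 < p.a) (hA : p.PosA) (hCMK : p.PosCMK) :
    ∃ k : ℝ, 0 < k ∧ ∀ U : State Ω, |mixed p U| ≤ k * energy p U := by
  obtain ⟨α, hα, hE⟩ := exists_energy_ge (Ω := Ω) hρ ha hA hCMK
  obtain ⟨c, hc, hP⟩ := State.exists_poincare hd hΩ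
  have inner_le : ∀ x y : L2 Ω, |⟪x, y⟫_ℝ| ≤ ‖x‖ ^ 2 + ‖y‖ ^ 2 := fun x y => by
    have h := abs_real_inner_le_norm x y
    nlinarith [sq_nonneg (‖x‖ - ‖y‖), sq_nonneg ‖x‖, sq_nonneg ‖y‖]
  refine ⟨(p.ρ + p.a) * (c + 1) / α, by positivity, fun U => ?_⟩
  have h₁ : |∑ i, ⟪U.u i, U.v i⟫_ℝ| ≤ c * U.normSqDu + U.normSqV := by
    refine (Finset.abs_sum_le_sum_abs _ _).trans
      ((Finset.sum_le_sum fun i _ => inner_le (U.u i) (U.v i)).trans ?_)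
    rw [Finset.sum_add_distrib]
    exact add_le_add_left (hP U).1 _
  have h₂ : |⟪U.τ, U.θ⟫_ℝ| ≤ c * U.normSqDτ + ‖U.θ‖ ^ 2 :=
    (inner_le _ _).trans (add_le_add_left (hP U).2 _)
  set X := U.normSqV + ‖U.θ‖ ^ 2 + U.normSqDu + U.normSqDτ with hX
  have n₁ := U.normSqV_nonneg
  have n₂ := U.normSqDu_nonneg
  have n₃ := U.normSqDτ_nonneg
  have n₄ := sq_nonneg ‖U.θ‖
  have h₁' : |∑ i, ⟪U.u i, U.v i⟫_ℝ| ≤ (c + 1) * X := by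
    rw [hX]; nlinarith [mul_nonneg hc.le n₁, mul_nonneg hc.le n₃, mul_nonneg hc.le n₄]
  have h₂' : |⟪U.τ, U.θ⟫_ℝ| ≤ (c + 1) * X := by
    rw [hX]; nlinarith [mul_nonneg hc.le n₁, mul_nonneg hc.le n₂, mul_nonneg hc.le n₄]
  have h₃ : X ≤ energy p U / α := (le_div_iff₀ hα).2 (by rw [mul_comm]; exact hE U)
  calc |mixed p U| ≤ p.ρ * |∑ i, ⟪U.u i, U.v i⟫_ℝ| + p.a * |⟪U.τ, U.θ⟫_ℝ| := by
        refine (abs_add_le _ _).trans (le_of_eq ?_)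
        rw [abs_mul, abs_mul, abs_of_pos hρ, abs_of_pos ha]
    _ ≤ p.ρ * ((c + 1) * X) + p.a * ((c + 1) * X) := by gcongr
    _ = (p.ρ + p.a) * (c + 1) * X := by ring
    _ ≤ (p.ρ + p.a) * (c + 1) * (energy p U / α) := by gcongr
    _ = (p.ρ + p.a) * (c + 1) / α * energy p U := by ring

theorem InGenerator.exists_form_le (hsymm : ∀ U V : State Ω, form p U V = form p V U)
    (hE : p.PosE) (hm : p.PosM) : ∃ α : ℝ, 0 < α ∧ ∀ U F : State Ω, InGenerator p U F →
      form p F U ≤ -α * (U.normSqV + F.normSqDτ) := by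
  obtain ⟨α₁, h₁, hE⟩ := hE
  obtain ⟨α₂, h₂, hm⟩ := hm
  refine ⟨min α₁ α₂, by positivity, fun U F h => ?_⟩
  have e₁ := sum_sq_le_of_matrix_posDef hE U.v
  have e₂ := sum_sq_le_of_matrix_posDef hm F.dτ
  have e₃ := (mul_le_mul_of_nonneg_right (min_le_left α₁ α₂) U.normSqV_nonneg).trans e₁
  have e₄ := (mul_le_mul_of_nonneg_right (min_le_right α₁ α₂) F.normSqDτ_nonneg).trans e₂
  rw [h.form_self_eq hsymm]
  linarith

theorem InGenerator.exists_multiplier_le (hd : 0 < d)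
    (hΩ : Bornology.IsBounded (Ω : Set (Space d)))
    (hρ : 0 < p.ρ) (ha : 0 < p.a) (hA : p.PosA) (hCMK : p.PosCMK) :
    ∃ k : ℝ, 0 ≤ k ∧ ∀ U F : State Ω, InGenerator p U F →
      p.ρ * (∑ i, (⟪F.u i, U.v i⟫_ℝ + ⟪U.u i, F.v i⟫_ℝ)) + p.a * (⟪F.τ, U.θ⟫_ℝ + ⟪U.τ, F.θ⟫_ℝ)
        ≤ -energy p U + k * (U.normSqV + F.normSqDτ) := by
  obtain ⟨α, hα, hE⟩ := exists_energy_ge (Ω := Ω) hρ ha hA hCMK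
  obtain ⟨c, hc, hP⟩ := State.exists_poincare hd hΩ
  -- The four Young estimates below cost ε(1 + c)‖∇u‖² + 2ε‖∇τ‖², at most α(‖∇u‖² + ‖∇τ‖²), hence at
  -- most one of the two available copies of the energy.
  set ε := α / (2 + c) with hε_def
  have hε : 0 < ε := by positivity
  have hεα : ε * (2 + c) = α := by rw [hε_def]; field_simp
  obtain ⟨k₁, hk₁, H₁⟩ := exists_abs_sum_inner_le (H := L2 Ω)
    (fun (iJ : Fin d × Fin d) (_ : Unit) => p.β iJ.2 iJ.1) hε
  obtain ⟨k₂, hk₂, H₂⟩ := exists_abs_sum_inner_le (H := L2 Ω) p.β hε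
  obtain ⟨k₃, hk₃, H₃⟩ := exists_abs_sum_inner_le (H := L2 Ω) p.E hε
  obtain ⟨k₄, hk₄, H₄⟩ := exists_abs_sum_inner_le (H := L2 Ω) p.m hε
  refine ⟨2 * p.ρ + (2 * p.a + k₁) * c + k₂ + k₃ + k₄, by positivity, fun U F h => ?_⟩
  have e₁ : |∑ i, ∑ J, p.β J i * ⟪U.θ, U.du i J⟫_ℝ| ≤ ε * U.normSqDu + k₁ * ‖U.θ‖ ^ 2 := by
    have := H₁ (fun iJ => U.du iJ.1 iJ.2) fun _ => U.θ
    simp only [Fintype.sum_prod_type, Finset.univ_unique, Finset.sum_singleton] at this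
    simpa only [State.normSqDu, real_inner_comm (U.du _ _) U.θ] using this
  have e₂ : |∑ i, ∑ J, p.β J i * ⟪U.v i, U.dτ J⟫_ℝ| ≤ ε * U.normSqDτ + k₂ * U.normSqV := by
    have := H₂ U.dτ U.v
    rw [Finset.sum_comm] at this
    simpa only [State.normSqDτ, State.normSqV, real_inner_comm (U.dτ _) (U.v _)] using this
  have e₃ : |∑ i, ∑ j, p.E i j * ⟪U.u i, U.v j⟫_ℝ| ≤ ε * (c * U.normSqDu) + k₃ * U.normSqV :=
    (H₃ U.u U.v).trans (add_le_add_left (mul_le_mul_of_nonneg_left (hP U).1 hε.le) _)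
  have e₄ : |∑ I, ∑ J, p.m I J * ⟪U.dτ I, F.dτ J⟫_ℝ| ≤ ε * U.normSqDτ + k₄ * F.normSqDτ :=
    H₄ U.dτ F.dτ
  -- The τ-component of `F` is θ, so Poincaré for `F` bounds θ by the dissipated ∇θ.
  have hθ : ‖U.θ‖ ^ 2 ≤ c * F.normSqDτ := by rw [← h.trd]; exact (hP F).2
  have hθ' : (2 * p.a + k₁) * ‖U.θ‖ ^ 2 ≤ (2 * p.a + k₁) * (c * F.normSqDτ) := by gcongr
  have n₁ := U.normSqV_nonneg
  have n₂ := U.normSqDu_nonneg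
  have n₃ := U.normSqDτ_nonneg
  have n₄ := F.normSqDτ_nonneg
  have hEU : ε * (2 + c) * (U.normSqDu + U.normSqDτ) ≤ energy p U := by
    rw [hεα]
    refine le_trans ?_ (hE U)
    gcongr
    have := sq_nonneg ‖U.θ‖
    linarith
  have hsmall : ε * U.normSqDu + ε * U.normSqDτ + ε * (c * U.normSqDu) + ε * U.normSqDτ
      ≤ ε * (2 + c) * (U.normSqDu + U.normSqDτ) := by
    have : 0 ≤ ε * U.normSqDu := by positivity
    have : 0 ≤ ε * c * U.normSqDτ := by positivity
    linarith
  have hlarge : 2 * p.ρ * U.normSqV + (2 * p.a + k₁) * (c * F.normSqDτ) + k₂ * U.normSqV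
      + k₃ * U.normSqV + k₄ * F.normSqDτ ≤
      (2 * p.ρ + (2 * p.a + k₁) * c + k₂ + k₃ + k₄) * (U.normSqV + F.normSqDτ) := by
    have : 0 ≤ (2 * p.ρ + k₂ + k₃) * F.normSqDτ := by positivity
    have : 0 ≤ ((2 * p.a + k₁) * c + k₄) * U.normSqV := by positivity
    linarith
  rw [h.multiplier]
  linarith [le_abs_self (∑ i, ∑ J, p.β J i * ⟪U.θ, U.du i J⟫_ℝ),
    le_abs_self (∑ i, ∑ J, p.β J i * ⟪U.v i, U.dτ J⟫_ℝ),
    neg_abs_le (∑ i, ∑ j, p.E i j * ⟪U.u i, U.v j⟫_ℝ),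
    neg_abs_le (∑ I, ∑ J, p.m I J * ⟪U.dτ I, F.dτ J⟫_ℝ)]

/-! ### Differentiation along curves of states -/

theorem continuous_energy : Continuous (energy p : State Ω → ℝ) := by
  unfold energy State.v State.θ State.du State.ddu State.dτ
  fun_prop

section Curve

variable {W : ℝ → State Ω} {W' : State Ω} {t : ℝ}

theorem hasDerivAt_clm_comp {X : Type*} [NormedAddCommGroup X] [NormedSpace ℝ X]
    (h : HasDerivAt W W' t) (T : State Ω →L[ℝ] X) :
    HasDerivAt (fun s => T (W s)) (T W') t :=
  T.hasFDerivAt.comp_hasDerivAt t h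

/-- The embedding of the first factor `(H²₀(Ω))^d` of the state space into `L²` products. -/
def jetU (Ω : Opens (Space d)) (i : Fin d) :
    State Ω →L[ℝ] L2 Ω × (Fin d → L2 Ω) × (Fin d → Fin d → L2 Ω) :=
  (H02 Ω).subtypeL ∘L ContinuousLinearMap.proj i ∘L ContinuousLinearMap.fst ℝ _ _

/-- The embedding of the third factor `H¹₀(Ω)` of the state space into `L²` products. -/
def jetτ (Ω : Opens (Space d)) : State Ω →L[ℝ] L2 Ω × (Fin d → L2 Ω) :=
  (H01 Ω).subtypeL ∘L ContinuousLinearMap.fst ℝ _ _ ∘L ContinuousLinearMap.snd ℝ _ _ ∘L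
    ContinuousLinearMap.snd ℝ _ _

/-- The coordinate projections of `(L²(Ω))^d`. -/
def projL2 (Ω : Opens (Space d)) (K : Fin d) : (Fin d → L2 Ω) →L[ℝ] L2 Ω :=
  ContinuousLinearMap.proj K

variable (h : HasDerivAt W W' t)
include h

theorem hasDerivAt_u (i : Fin d) : HasDerivAt (fun s => (W s).u i) (W'.u i) t :=
  hasDerivAt_clm_comp h (ContinuousLinearMap.fst ℝ _ _ ∘L jetU Ω i)

theorem hasDerivAt_du (i K : Fin d) : HasDerivAt (fun s => (W s).du i K) (W'.du i K) t :=
  hasDerivAt_clm_comp h (projL2 Ω K ∘L ContinuousLinearMap.fst ℝ _ _ ∘L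
    ContinuousLinearMap.snd ℝ _ _ ∘L jetU Ω i)

theorem hasDerivAt_ddu (i K L : Fin d) : HasDerivAt (fun s => (W s).ddu i K L) (W'.ddu i K L) t :=
  hasDerivAt_clm_comp h (projL2 Ω L ∘L
    ContinuousLinearMap.proj (R := ℝ) (φ := fun _ : Fin d => Fin d → L2 Ω) K ∘L
    ContinuousLinearMap.snd ℝ _ _ ∘L
    ContinuousLinearMap.snd ℝ _ _ ∘L jetU Ω i)

theorem hasDerivAt_v (i : Fin d) : HasDerivAt (fun s => (W s).v i) (W'.v i) t :=
  hasDerivAt_clm_comp h (projL2 Ω i ∘L ContinuousLinearMap.fst ℝ _ _ ∘L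
    ContinuousLinearMap.snd ℝ _ _)

theorem hasDerivAt_τ : HasDerivAt (fun s => (W s).τ) W'.τ t :=
  hasDerivAt_clm_comp h (ContinuousLinearMap.fst ℝ _ _ ∘L jetτ Ω)

theorem hasDerivAt_dτ (K : Fin d) : HasDerivAt (fun s => (W s).dτ K) (W'.dτ K) t :=
  hasDerivAt_clm_comp h (projL2 Ω K ∘L ContinuousLinearMap.snd ℝ _ _ ∘L jetτ Ω)

theorem hasDerivAt_θ : HasDerivAt (fun s => (W s).θ) W'.θ t :=
  hasDerivAt_clm_comp h (ContinuousLinearMap.snd ℝ _ _ ∘L ContinuousLinearMap.snd ℝ _ _ ∘L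
    ContinuousLinearMap.snd ℝ _ _)

theorem hasDerivAt_mixed (p : Coeffs d) : HasDerivAt (fun s => mixed p (W s))
    (p.ρ * (∑ i, (⟪W'.u i, (W t).v i⟫_ℝ + ⟪(W t).u i, W'.v i⟫_ℝ))
      + p.a * (⟪W'.τ, (W t).θ⟫_ℝ + ⟪(W t).τ, W'.θ⟫_ℝ)) t := by
  refine ((HasDerivAt.fun_sum fun i _ =>
    (hasDerivAt_u h i).inner ℝ (hasDerivAt_v h i)).const_mul _ |>.add
    (((hasDerivAt_τ h).inner ℝ (hasDerivAt_θ h)).const_mul _)).congr_deriv ?_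
  simp only [add_comm]

theorem hasDerivAt_form_self (p : Coeffs d) : HasDerivAt (fun s => form p (W s) (W s))
    (form p W' (W t) + form p (W t) W') t := by
  have hC := HasDerivAt.fun_sum fun i (_ : i ∈ Finset.univ) => HasDerivAt.fun_sum fun I
    (_ : I ∈ Finset.univ) => HasDerivAt.fun_sum fun J (_ : J ∈ Finset.univ) =>
    HasDerivAt.fun_sum fun K (_ : K ∈ Finset.univ) => HasDerivAt.fun_sum fun L
    (_ : L ∈ Finset.univ) => HasDerivAt.fun_sum fun j (_ : j ∈ Finset.univ) =>
    ((hasDerivAt_ddu h i J I).inner ℝ (hasDerivAt_ddu h j L K)).const_mul (p.C i I J K L j)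
  have hA := HasDerivAt.fun_sum fun i (_ : i ∈ Finset.univ) => HasDerivAt.fun_sum fun K
    (_ : K ∈ Finset.univ) => HasDerivAt.fun_sum fun L (_ : L ∈ Finset.univ) =>
    HasDerivAt.fun_sum fun j (_ : j ∈ Finset.univ) =>
    ((hasDerivAt_du h i K).inner ℝ (hasDerivAt_du h j L)).const_mul (p.A i K L j)
  have hK := HasDerivAt.fun_sum fun I (_ : I ∈ Finset.univ) => HasDerivAt.fun_sum fun J
    (_ : J ∈ Finset.univ) => ((hasDerivAt_dτ h J).inner ℝ (hasDerivAt_dτ h I)).const_mul (p.K I J)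
  have hM := HasDerivAt.fun_sum fun i (_ : i ∈ Finset.univ) => HasDerivAt.fun_sum fun J
    (_ : J ∈ Finset.univ) => HasDerivAt.fun_sum fun K (_ : K ∈ Finset.univ) =>
    HasDerivAt.fun_sum fun L (_ : L ∈ Finset.univ) =>
    ((hasDerivAt_ddu h i K J).inner ℝ (hasDerivAt_dτ h L)).const_mul (p.M i J K L)
  have hv := (HasDerivAt.fun_sum fun i (_ : i ∈ Finset.univ) =>
    (hasDerivAt_v h i).inner ℝ (hasDerivAt_v h i)).const_mul p.ρ
  have hθ := ((hasDerivAt_θ h).inner ℝ (hasDerivAt_θ h)).const_mul p.a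
  -- On the diagonal the two M-sums of the form agree up to renaming indices, so `hM` serves twice.
  refine ((((((hv.add hθ).add hA).add hC).add hK).add hM).add hM).congr_deriv ?_
  simp only [form, mul_add, Finset.sum_add_distrib]
  ring

end Curve

/-! ### Exponential decay -/

/-- With the integrating factor, f(t)e^{ct} is nonincreasing on [0, ∞). -/
theorem le_mul_exp_of_deriv_le {f f' : ℝ → ℝ} {c : ℝ} (hf : ∀ t, HasDerivAt f (f' t) t)
    (h : ∀ t, 0 ≤ t → f' t ≤ -c * f t) {t : ℝ} (ht : 0 ≤ t) :
    f t ≤ f 0 * Real.exp (-c * t) := by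
  have hg : ∀ t, HasDerivAt (fun s => f s * Real.exp (c * s))
      (f' t * Real.exp (c * t) + f t * (Real.exp (c * t) * c)) t := fun t =>
    (hf t).mul (((hasDerivAt_id t).const_mul c).exp.congr_deriv (by simp))
  have hanti : AntitoneOn (fun s => f s * Real.exp (c * s)) (Ici 0) := by
    refine antitoneOn_of_deriv_nonpos (convex_Ici 0)
      (fun t _ => (hg t).continuousAt.continuousWithinAt)
      (fun t _ => (hg t).differentiableAt.differentiableWithinAt) fun t ht => ?_
    rw [interior_Ici] at ht
    rw [(hg t).deriv]
    nlinarith [mul_le_mul_of_nonneg_right (h t (le_of_lt ht)) (Real.exp_pos (c * t)).le]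
  have h1 := hanti self_mem_Ici ht ht
  simp only [mul_zero, Real.exp_zero, mul_one] at h1
  rw [neg_mul, Real.exp_neg, ← div_eq_mul_inv, le_div_iff₀ (Real.exp_pos _)]
  exact h1

theorem exists_decay_of_classical (hd : 0 < d) (hΩ : Bornology.IsBounded (Ω : Set (Space d)))
    (hρ : 0 < p.ρ) (ha : 0 < p.a) (hA : p.PosA) (hCMK : p.PosCMK)
    (hsymm : ∀ U V : State Ω, form p U V = form p V U) (hE : p.PosE) (hm : p.PosM) :
    ∃ C : ℝ, 0 < C ∧ ∃ c₀ : ℝ, 0 < c₀ ∧ ∀ W W' : ℝ → State Ω,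
      (∀ t, HasDerivAt W (W' t) t) → (∀ t, 0 ≤ t → InGenerator p (W t) (W' t)) →
        ∀ t, 0 ≤ t → energy p (W t) ≤ C * energy p (W 0) * Real.exp (-c₀ * t) := by
  obtain ⟨k, hk, hmix⟩ := exists_abs_mixed_le (Ω := Ω) hd hΩ hρ ha hA hCMK
  obtain ⟨α, hα, hform⟩ := InGenerator.exists_form_le hsymm hE hm
  obtain ⟨k', hk', hmult⟩ := InGenerator.exists_multiplier_le (Ω := Ω) hd hΩ hρ ha hA hCMK
  -- The summand k + 1 gives 𝓔 ≤ N𝓔 + `mixed`; the summand k'/α gives Nα ≥ k', so the dissipation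
  -- absorbs the error of the multiplier estimate.
  set N := k + 1 + k' / α with hN
  have hN0 : 0 < N := by positivity
  refine ⟨N + k, by positivity, (N + k)⁻¹, by positivity, fun W W' hW hgen t ht => ?_⟩
  have hlower : ∀ U : State Ω, energy p U ≤ N * energy p U + mixed p U := fun U => by
    have h0 : 0 ≤ energy p U :=
      nonneg_of_mul_nonneg_right ((abs_nonneg _).trans (hmix U)) hk
    have h1 : 0 ≤ k' / α * energy p U := by positivity
    have h2 := (neg_le_neg (hmix U)).trans (neg_abs_le _)
    rw [hN]; linarith
  have hupper : ∀ U : State Ω, N * energy p U + mixed p U ≤ (N + k) * energy p U := fun U => by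
    have := (le_abs_self _).trans (hmix U)
    linarith
  have hderiv : ∀ t, HasDerivAt (fun s => N * energy p (W s) + mixed p (W s))
      (N * form p (W' t) (W t)
        + (p.ρ * (∑ i, (⟪(W' t).u i, (W t).v i⟫_ℝ + ⟪(W t).u i, (W' t).v i⟫_ℝ))
          + p.a * (⟪(W' t).τ, (W t).θ⟫_ℝ + ⟪(W t).τ, (W' t).θ⟫_ℝ))) t := fun t => by
    have h1 : HasDerivAt (fun s => energy p (W s)) (form p (W' t) (W t)) t := by
      simp only [energy_eq_form]
      refine ((hasDerivAt_form_self (hW t) p).const_mul _).congr_deriv ?_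
      rw [hsymm (W t) (W' t)]
      ring
    exact (h1.const_mul N).add (hasDerivAt_mixed (hW t) p)
  have hle := le_mul_exp_of_deriv_le (c := (N + k)⁻¹) hderiv (fun t ht => by
    have h1 := mul_le_mul_of_nonneg_left (hform _ _ (hgen t ht)) hN0.le
    have h2 := hmult _ _ (hgen t ht)
    have h3 : (N + k)⁻¹ * (N * energy p (W t) + mixed p (W t)) ≤ energy p (W t) := by
      rw [inv_mul_le_iff₀ (by positivity)]
      exact hupper _
    have h4 : k' ≤ N * α := by
      have : N * α = (k + 1) * α + k' := by rw [hN]; field_simp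
      rw [this]; nlinarith
    have h5 := mul_le_mul_of_nonneg_right h4
      (add_nonneg (W t).normSqV_nonneg (W' t).normSqDτ_nonneg)
    linarith) ht
  refine (hlower _).trans (hle.trans ?_)
  gcongr
  exact hupper _

/-! ### Mild solutions -/

theorem InGenerator.sub {U F U₁ F₁ : State Ω} (h : InGenerator p U F) (h₁ : InGenerator p U₁ F₁) :
    InGenerator p (U - U₁) (F - F₁) where
  fst i := congrArg₂ (· - ·) (h.fst i) (h₁.fst i)
  trd := congrArg₂ (· - ·) h.trd h₁.trd
  snd i φ := by
    have e : ∀ V V₁ : State Ω, (∀ i, (V - V₁).v i = V.v i - V₁.v i) ∧ (V - V₁).θ = V.θ - V₁.θ ∧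
        (∀ i K, (V - V₁).du i K = V.du i K - V₁.du i K) ∧
        (∀ i K L, (V - V₁).ddu i K L = V.ddu i K L - V₁.ddu i K L) ∧
        (∀ K, (V - V₁).dτ K = V.dτ K - V₁.dτ K) := fun _ _ =>
      ⟨fun _ => rfl, rfl, fun _ _ => rfl, fun _ _ _ => rfl, fun _ => rfl⟩
    simp only [e, inner_sub_left, mul_sub, Finset.sum_sub_distrib, h.snd i φ, h₁.snd i φ]
    ring
  fth φ := by
    have e : ∀ V V₁ : State Ω, (V - V₁).θ = V.θ - V₁.θ ∧
        (∀ i K, (V - V₁).du i K = V.du i K - V₁.du i K) ∧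
        (∀ i K L, (V - V₁).ddu i K L = V.ddu i K L - V₁.ddu i K L) ∧
        (∀ K, (V - V₁).dτ K = V.dτ K - V₁.dτ K) := fun _ _ =>
      ⟨rfl, fun _ _ => rfl, fun _ _ _ => rfl, fun _ => rfl⟩
    simp only [e, inner_sub_left, mul_sub, Finset.sum_sub_distrib, h.fth φ, h₁.fth φ]
    ring

theorem energy_smul (p : Coeffs d) (c : ℝ) (U : State Ω) :
    energy p (c • U) = c ^ 2 * energy p U := by
  have e : (∀ i, (c • U).v i = c • U.v i) ∧ (c • U).θ = c • U.θ ∧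
      (∀ i K, (c • U).du i K = c • U.du i K) ∧ (∀ i K L, (c • U).ddu i K L = c • U.ddu i K L) ∧
      (∀ K, (c • U).dτ K = c • U.dτ K) :=
    ⟨fun _ => rfl, rfl, fun _ _ => rfl, fun _ _ _ => rfl, fun _ => rfl⟩
  simp only [energy, e, real_inner_smul_left, real_inner_smul_right, mul_add, Finset.mul_sum]
  congr 1
  · congr 1
    · congr 1
      · congr 1
        · exact Finset.sum_congr rfl fun _ _ => by ring
        · ring
      · exact Finset.sum_congr rfl fun _ _ => Finset.sum_congr rfl fun _ _ =>
          Finset.sum_congr rfl fun _ _ => Finset.sum_congr rfl fun _ _ => by ring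
    · exact Finset.sum_congr rfl fun _ _ => Finset.sum_congr rfl fun _ _ =>
        Finset.sum_congr rfl fun _ _ => Finset.sum_congr rfl fun _ _ =>
        Finset.sum_congr rfl fun _ _ => Finset.sum_congr rfl fun _ _ => by ring
  · congr 1
    · exact Finset.sum_congr rfl fun _ _ => Finset.sum_congr rfl fun _ _ => by ring
    · exact Finset.sum_congr rfl fun _ _ => Finset.sum_congr rfl fun _ _ =>
        Finset.sum_congr rfl fun _ _ => Finset.sum_congr rfl fun _ _ => by ring

/-- Steklov averages of a continuous function converge pointwise to the function. -/
theorem tendsto_average {X : Type*} [NormedAddCommGroup X] [NormedSpace ℝ X] [CompleteSpace X]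
    {V : ℝ → X} (hV : Continuous V) (t : ℝ) :
    Filter.Tendsto (fun h : ℝ => h⁻¹ • ∫ s in t..t + h, V s) (nhdsWithin 0 (Ioi 0))
      (nhds (V t)) := by
  have hd : HasDerivAt (fun r => ∫ s in t..r, V s) (V t) t :=
    (hV.integral_hasStrictDerivAt t t).hasDerivAt
  have := hd.tendsto_slope_zero_right
  simpa using this

theorem IsMildSolution.energy_le {C c₀ : ℝ}
    (hdecay : ∀ W W' : ℝ → State Ω,
      (∀ t, HasDerivAt W (W' t) t) → (∀ t, 0 ≤ t → InGenerator p (W t) (W' t)) →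
        ∀ t, 0 ≤ t → energy p (W t) ≤ C * energy p (W 0) * Real.exp (-c₀ * t))
    {U₀ : State Ω} {U : ℝ → State Ω} (hU : IsMildSolution p U₀ U) {t : ℝ} (ht : 0 ≤ t) :
    energy p (U t) ≤ C * energy p (U 0) * Real.exp (-c₀ * t) := by
  -- Extending U by its initial value to negative times gives a continuous curve on ℝ, whose
  -- averages are differentiable at every time.
  set V : ℝ → State Ω := fun s => U (max s 0) with hVdef
  have hV : Continuous V := hU.continuousOn.comp_continuous (by fun_prop) fun s => le_max_right s 0
  have hVU : ∀ s, 0 ≤ s → V s = U s := fun s hs => by simp only [hVdef, max_eq_left hs]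
  have hi : ∀ a b, IntervalIntegrable V volume a b := hV.intervalIntegrable
  have hgen : ∀ s, 0 ≤ s → InGenerator p (∫ r in (0 : ℝ)..s, V r) (V s - U₀) := fun s hs => by
    have h := hU.integrated s hs
    rw [hVU s hs]
    convert h using 1
    refine intervalIntegral.integral_congr fun r hr => hVU r ?_
    rw [uIcc_of_le hs] at hr
    exact hr.1
  have key : ∀ h : ℝ, 0 < h → energy p (h⁻¹ • ∫ s in t..t + h, V s) ≤
      C * energy p (h⁻¹ • ∫ s in (0 : ℝ)..0 + h, V s) * Real.exp (-c₀ * t) := fun h hh => by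
    have hsub : ∀ t, ∫ s in t..t + h, V s = (∫ s in (0 : ℝ)..t + h, V s) - ∫ s in (0 : ℝ)..t, V s :=
      fun t => (intervalIntegral.integral_interval_sub_left (hi _ _) (hi _ _)).symm
    have hder : ∀ t, HasDerivAt (fun t => ∫ s in t..t + h, V s) (V (t + h) - V t) t := fun t => by
      simp only [hsub]
      have h1 : HasDerivAt (fun t => ∫ s in (0 : ℝ)..t, V s) (V (t + h)) (t + h) :=
        (hV.integral_hasStrictDerivAt 0 (t + h)).hasDerivAt
      have h2 : HasDerivAt (fun t => ∫ s in (0 : ℝ)..t, V s) (V t) t :=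
        (hV.integral_hasStrictDerivAt 0 t).hasDerivAt
      exact (h1.comp_add_const t h).sub h2
    have h1 := hdecay (fun t => ∫ s in t..t + h, V s) _ hder (fun s hs => by
      -- Subtracting the integrated equations at s + h and s removes `U₀`: the integral over [s, s +
      -- h] solves the equation classically.
      have h3 := (hgen (s + h) (by positivity)).sub (hgen s hs)
      simp only [hsub]
      rwa [sub_sub_sub_cancel_right] at h3) t ht
    rw [energy_smul, energy_smul]
    have h2 := mul_le_mul_of_nonneg_left h1 (sq_nonneg h⁻¹)
    linarith
  have hlim : ∀ s, 0 ≤ s → Filter.Tendsto (fun h : ℝ => energy p (h⁻¹ • ∫ r in s..s + h, V r))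
      (nhdsWithin 0 (Ioi 0)) (nhds (energy p (U s))) := fun s hs => by
    rw [← hVU s hs]
    exact (continuous_energy.tendsto _).comp (tendsto_average hV s)
  exact le_of_tendsto_of_tendsto (hlim t ht) (((hlim 0 le_rfl).const_mul C).mul_const _)
    (eventually_nhdsWithin_of_forall fun h hh => key h hh)

end NonsimpleThermo

end

theorem mainTheorem2 {d : ℕ} (hd : 0 < d)
    (Ω : TopologicalSpace.Opens (NonsimpleThermo.Space d))
    (hΩ : Bornology.IsBounded (Ω : Set (NonsimpleThermo.Space d)))
    (p : NonsimpleThermo.Coeffs d) (hρ : 0 < p.ρ) (ha : 0 < p.a)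
    (hA : p.PosA) (hCMK : p.PosCMK)
    (hsymm : ∀ U V : NonsimpleThermo.State Ω,
      NonsimpleThermo.form p U V = NonsimpleThermo.form p V U)
    (hE : p.PosE) (hm : p.PosM) :
    ∃ C : ℝ, 0 < C ∧ ∃ c₀ : ℝ, 0 < c₀ ∧
      ∀ (U₀ : NonsimpleThermo.State Ω) (U : ℝ → NonsimpleThermo.State Ω),
        NonsimpleThermo.IsMildSolution p U₀ U →
          ∀ t : ℝ, 0 ≤ t →
            NonsimpleThermo.energy p (U t) ≤
              C * NonsimpleThermo.energy p (U 0) * Real.exp (-c₀ * t) := by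
  obtain ⟨C, hC, c₀, hc₀, h⟩ :=
    NonsimpleThermo.exists_decay_of_classical hd hΩ hρ ha hA hCMK hsymm hE hm
  exact ⟨C, hC, c₀, hc₀, fun U₀ U hU t ht => hU.energy_le h ht⟩
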